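/- Let $D\ge 3$. Consider the model of two real symmetric tensors $T,P$ of rank $D$ and size $N$ with action $$S(T,P)=\sum_{a} T_{a_1\dots a_D}P_{a_1\dots a_D}+\frac{\lambda}{N^{D(D-1)/4}}\big(I(T)+I(P)\big),\qquad I(T)=\sum_{(a_{ij})}\ \prod_{i=0}^{D}T_{a_{i,i\oplus 1}\dots a_{i,i\oplus D}}\prod_{0\le i<j\le D}\delta_{a_{ij}a_{ji}},$$ where $\oplus$ is addition modulo $D+1$ (the contraction pattern of the interaction is the complete graph $K_{D+1}$). The propagator is $\langle T_{a_1\dots a_D}P_{b_1\dots b_D}\rangle_0=\frac1{D!}\sum_{\sigma\in\mathfrak S_D}\prod_i\delta_{a_i b_{\sigma(i)}}$. A Feynman graph $G$ of the two point function consists of finitely many interaction vertices $I(T)$ and $I(P)$, one insertion $\sum_a T_{a_1\dots a_D}P_{a_1\dots a_D}$ (regarded as a mark on an edge, not as a vertex), a perfect matching of all the tensors $T$ with all the tensors $P$, and, for every matched pair, a permutation $\sigma\in\mathfrak S_D$ that says which index of $T$ is joined by a strand to which index of $P$; with no vertices one obtains the ring graphs. The strands are glued along the index contractions in the vertices and in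 the insertion, and close into the faces of $G$. Let $V(G)$ and $F(G)$ be the numbers of vertices and of faces, and define the degree of a connected graph by $$\omega(G)=D+\frac{D(D-1)}4V(G)-F(G).$$ For every connected Feynman graph $G$ one has $\omega(G)\ge 0$. The amplitude of $G$, that is $N^{-D-\frac{D(D-1)}4V(G)}$ times the sum over all tensor indices in $\{1,\dots,N\}$ of the product of the Kronecker deltas of the insertion, the vertices and the strands, equals $N^{-\omega(G)}$ for every $N\ge 1$. Hence the model admits a $1/N$ expansion, in the sense that all its connected Feynman graphs have non-negative degree and there exist connected Feynman graphs of degree $0$. -/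

import Mathlib

noncomputable section

/-- A stranded Feynman graph of the two point function of the rank `D` model with two real
symmetric tensors `T`, `P`, interactions given by the complete graph on `D + 1` tensors, and
propagator `⟨T_{a_1 … a_D} P_{b_1 … b_D}⟩ = (1 / D!) ∑_σ ∏_i δ_{a_i b_{σ i}}`: one term of the
Wick expansion.

There are `numT` interaction vertices made of `D + 1` tensors `T`, `numP` interaction vertices made
of `D + 1` tensors `P`, and one insertion `∑_a T_{a_1 … a_D} P_{a_1 … a_D}`, drawn as a mark,
oriented from `T` to `P`, on an edge. A tensor (half edge) is `some (v, i)`, the `i`-th tensor of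
the vertex `v`, or `none`, the tensor of the insertion. Every `T` is paired by a propagator with a
`P`, and every propagator carries a permutation of its `D` strands. Without vertices one obtains
the ring graphs, a single marked edge closing onto itself. -/
structure FeynmanGraph (D : ℕ) where
  /-- the number of interaction vertices of type `T` -/
  numT : ℕ
  /-- the number of interaction vertices of type `P` -/
  numP : ℕ
  /-- the propagators: the perfect matching of the tensors `T` with the tensors `P` -/
  pairing : Option (Fin numT × Fin (D + 1)) ≃ Option (Fin numP × Fin (D + 1))
  /-- the permutation of the strands along each propagator -/
  strand : Option (Fin numT × Fin (D + 1)) → Equiv.Perm (Fin D)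

namespace FeynmanGraph

variable {D : ℕ} (G : FeynmanGraph D)

/-- The tensors `T`. -/
abbrev HalfT : Type := Option (Fin G.numT × Fin (D + 1))

/-- The tensors `P`. -/
abbrev HalfP : Type := Option (Fin G.numP × Fin (D + 1))

/-- The tensor indices (ends of strands): a tensor together with one of its `D` positions. -/
abbrev Index : Type := (G.HalfT × Fin D) ⊕ (G.HalfP × Fin D)

/-- The number `V(G)` of vertices (the insertion is a mark on an edge and not a vertex). -/
def numVertices : ℕ := G.numT + G.numP

/-- The elementary gluings of indices. In a vertex the `k`-th index (`k = 0, …, D - 1`) of the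
`i`-th tensor is the index `a_{i j}` with `j = i + (k + 1)` modulo `D + 1`. It is contracted
with `a_{j i}`, and `i = j + (D - k)` modulo `D + 1`, so `a_{j i}` is at the reversed
position `D - 1 - k`. -/
inductive Glued : G.Index → G.Index → Prop
  | propagator (h : G.HalfT) (k : Fin D) :
      Glued (Sum.inl (h, k)) (Sum.inr (G.pairing h, G.strand h k))
  | insertion (k : Fin D) : Glued (Sum.inl (none, k)) (Sum.inr (none, k))
  | vertexT (v : Fin G.numT) (i : Fin (D + 1)) (k : Fin D) :
      Glued (Sum.inl (some (v, i), k)) (Sum.inl (some (v, i + k.succ), k.rev))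
  | vertexP (v : Fin G.numP) (i : Fin (D + 1)) (k : Fin D) :
      Glued (Sum.inr (some (v, i), k)) (Sum.inr (some (v, i + k.succ), k.rev))

/-- A face: a closed chain of glued strands, that is, a class of the equivalence relation
generated by the gluings. -/
def Face : Type := Quot G.Glued

/-- The number `F(G)` of faces. -/
def numFaces : ℕ := Nat.card G.Face

/-- The nodes for connectedness: the insertion (`none`) and the vertices of the two types. -/
abbrev Node : Type := Option (Fin G.numT ⊕ Fin G.numP)

/-- The node to which a tensor `T` belongs. -/
def nodeT (h : G.HalfT) : G.Node := h.map fun x => Sum.inl x.1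

/-- The node to which a tensor `P` belongs. -/
def nodeP (h : G.HalfP) : G.Node := h.map fun x => Sum.inr x.1

/-- The graph is connected. -/
def Connected : Prop :=
  (SimpleGraph.fromRel fun x y : G.Node =>
    ∃ h : G.HalfT, x = G.nodeT h ∧ y = G.nodeP (G.pairing h)).Connected

/-- The degree `ω(G) = D + D (D - 1) V(G) / 4 - F(G)` of a connected graph. -/
def degree : ℝ :=
  (D : ℝ) + (D : ℝ) * ((D : ℝ) - 1) / 4 * (G.numVertices : ℝ) - (G.numFaces : ℝ)

/-- The Kronecker delta of two indices. -/
def delta {N : ℕ} (a b : Fin N) : ℝ := if a = b then 1 else 0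

/-- The contraction `∏_{i < j} δ_{a_{i j} a_{j i}}` of the indices of the `D + 1` tensors of a
vertex, where `a i k` stands for `a_{i j}` with `j = i + (k + 1)` modulo `D + 1`. -/
def vertexKernel {N : ℕ} (a : Fin (D + 1) → Fin D → Fin N) : ℝ :=
  ∏ p : Fin (D + 1) × Fin D with p.1 < p.1 + p.2.succ,
    delta (a p.1 p.2) (a (p.1 + p.2.succ) p.2.rev)

/-- The Feynman amplitude for tensors of size `N`, with the prefactor `N ^ (-D)` of the two point
function and a factor `N ^ (-D (D - 1) / 4)` for every vertex (without coupling constants and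
combinatorial factors, which do not depend on `N`): the sum, over the indices `a` of the tensors
`T` and `b` of the tensors `P`, of the contractions in the insertion and in the vertices and of
the propagators. -/
def amplitude (N : ℕ) : ℝ :=
  (N : ℝ) ^ (-(D : ℝ)) *
    ((N : ℝ) ^ (-((D : ℝ) * ((D : ℝ) - 1) / 4))) ^ G.numVertices *
    ∑ a : G.HalfT → Fin D → Fin N, ∑ b : G.HalfP → Fin D → Fin N,
      (∏ k, delta (a none k) (b none k)) *
      (∏ v, vertexKernel fun i k => a (some (v, i)) k) *
      (∏ v, vertexKernel fun i k => b (some (v, i)) k) *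
      ∏ h, ∏ k, delta (a h k) (b (G.pairing h) (G.strand h k))

end FeynmanGraph

/-- The rank `D` model admits a `1/N` expansion: all its connected graphs have non-negative
degree and there are connected graphs of degree zero. -/
def AdmitsLargeNExpansion (D : ℕ) : Prop :=
  (∀ G : FeynmanGraph D, G.Connected → 0 ≤ G.degree) ∧
    ∃ G : FeynmanGraph D, G.Connected ∧ G.degree = 0

end

noncomputable section

/-! ### Bipolar numberings of graphs without cut vertices. -/

section BipolarNumbering

variable {W : Type*} [DecidableEq W]

/-- Every vertex of `C` is linked to `t` inside `C`: every nonempty subset of `C` that avoids `t` has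
an edge to the rest of `C`. -/
def LinkedTo (r : W → W → Prop) (t : W) (C : Finset W) : Prop :=
  ∀ K ⊆ C, K.Nonempty → t ∉ K → ∃ x ∈ K, ∃ y ∈ C, y ∉ K ∧ r x y

/-- No vertex separates a set of vertices from the two terminals `s` and `t`. -/
def NoCutVertex (r : W → W → Prop) (s t : W) : Prop :=
  ∀ K : Finset W, K.Nonempty → s ∉ K → t ∉ K → ∀ v, v ∉ K → ∃ x ∈ K, ∃ y, y ∉ K ∧ y ≠ v ∧ r x y

/-- Here `K` is a part of `C` that the removal of `v` separates from `t`. Since `v` is not a cut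
vertex, some `x ∈ K` has a neighbour outside `C`. If `x` cannot be removed either, it separates some
`K'` from `t`, and `K ∩ K'` is a smaller part separated by `x`; so the search ends. -/
theorem exists_linkedTo_erase_of_blocked {r : W → W → Prop} (symm : ∀ x y, r x y → r y x) {s t : W}
    (cut : NoCutVertex r s t) {C : Finset W} (hC : LinkedTo r t C) (hs : s ∉ C) (n : ℕ) :
    ∀ v ∈ C, v ≠ t → (∃ y, y ∉ C ∧ r v y) → ∀ K ⊆ C.erase v, K.Nonempty → t ∉ K →
      (∀ x ∈ K, ∀ y ∈ C, y ≠ v → r x y → y ∈ K) → K.card ≤ n →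
      ∃ u ∈ C, u ≠ t ∧ (∃ y, y ∉ C ∧ r u y) ∧ LinkedTo r t (C.erase u) := by
  induction n with
  | zero =>
    intro v _ _ _ K _ hne _ _ hn
    exact absurd hn (by have := hne.card_pos; omega)
  | succ n ih =>
    intro v hv hvt hvy K hK hne htK hclosed hn
    have hKC : K ⊆ C := fun x hx => Finset.mem_of_mem_erase (hK hx)
    have hvK : v ∉ K := fun h => (Finset.mem_erase.1 (hK h)).1 rfl
    obtain ⟨x, hx, y, hyK, hyv, hxy⟩ := cut K hne (fun h => hs (hKC h)) htK v hvK
    have hyC : y ∉ C := fun h => hyK (hclosed x hx y h hyv hxy)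
    have hxt : x ≠ t := fun h => htK (h ▸ hx)
    by_cases hlink : LinkedTo r t (C.erase x)
    · exact ⟨x, hKC hx, hxt, ⟨y, hyC, hxy⟩, hlink⟩
    unfold LinkedTo at hlink
    push Not at hlink
    obtain ⟨K', hK', hne', htK', hcl'⟩ := hlink
    have hK'C : K' ⊆ C := fun z hz => Finset.mem_of_mem_erase (hK' hz)
    have hxK' : x ∉ K' := fun h => (Finset.mem_erase.1 (hK' h)).1 rfl
    have hclosed' : ∀ z ∈ K', ∀ w ∈ C, w ≠ x → r z w → w ∈ K' := by
      intro z hz w hw hwx hzw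
      by_contra hwK
      exact hcl' z hz w (Finset.mem_erase.2 ⟨hwx, hw⟩) hwK hzw
    -- Otherwise `K ∪ K'` contains both separating vertices and no edge leaves it inside `C`.
    have hvK' : v ∉ K' := by
      intro hvK'
      obtain ⟨z, hz, w, hw, hwn, hzw⟩ := hC (K ∪ K') (Finset.union_subset hKC hK'C)
        (hne.mono Finset.subset_union_left) (by simp [htK, htK'])
      simp only [Finset.mem_union, not_or] at hz hwn
      rcases hz with hz | hz
      · exact hwn.1 (hclosed z hz w hw (fun h => hwn.2 (h ▸ hvK')) hzw)
      · exact hwn.2 (hclosed' z hz w hw (fun h => hwn.1 (h ▸ hx)) hzw)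
    -- An edge leaving `K'` inside `C` must end at `x ∈ K`; read backwards from `x`, it shows that
    -- its origin lies in `K`.
    have hinter : (K ∩ K').Nonempty := by
      by_contra hempty
      have hdisj : ∀ z ∈ K', z ∉ K := fun z hz hzK =>
        hempty ⟨z, Finset.mem_inter.2 ⟨hzK, hz⟩⟩
      obtain ⟨z, hz, w, hw, hwn, hzw⟩ := hC K' hK'C hne' htK'
      have hwx : w = x := by
        by_contra hwx
        exact hwn (hclosed' z hz w hw hwx hzw)
      subst hwx
      exact hdisj z hz (hclosed w hx z (hK'C hz) (fun h => hvK' (h ▸ hz)) (symm _ _ hzw))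
    refine ih x (hKC hx) hxt ⟨y, hyC, hxy⟩ (K ∩ K')
      (fun z hz => hK' (Finset.mem_inter.1 hz).2) hinter
      (fun h => htK (Finset.mem_inter.1 h).1) ?_ ?_
    · intro z hz w hw hwx hzw
      have hz := Finset.mem_inter.1 hz
      have hwK' := hclosed' z hz.2 w hw hwx hzw
      exact Finset.mem_inter.2 ⟨hclosed z hz.1 w hw (fun h => hvK' (h ▸ hwK')) hzw, hwK'⟩
    · have : (K ∩ K').card < K.card := Finset.card_lt_card
        ⟨Finset.inter_subset_left, fun h => hxK' (Finset.mem_inter.1 (h hx)).2⟩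
      omega

theorem exists_linkedTo_erase {r : W → W → Prop} (symm : ∀ x y, r x y → r y x) {s t : W}
    (cut : NoCutVertex r s t) {C : Finset W} (hC : LinkedTo r t C) (hs : s ∉ C)
    (hne : (C.erase t).Nonempty) :
    ∃ u ∈ C, u ≠ t ∧ (∃ y, y ∉ C ∧ r u y) ∧ LinkedTo r t (C.erase u) := by
  obtain ⟨x, hx, y, hy, hyt, hxy⟩ := cut (C.erase t) hne
    (fun h => hs (Finset.mem_of_mem_erase h)) (Finset.notMem_erase t C) t (Finset.notMem_erase t C)
  have hyC : y ∉ C := fun h => hy (Finset.mem_erase.2 ⟨hyt, h⟩)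
  obtain ⟨hxt, hxC⟩ := Finset.mem_erase.1 hx
  by_cases hlink : LinkedTo r t (C.erase x)
  · exact ⟨x, hxC, hxt, ⟨y, hyC, hxy⟩, hlink⟩
  unfold LinkedTo at hlink
  push Not at hlink
  obtain ⟨K, hK, hKne, htK, hcl⟩ := hlink
  refine exists_linkedTo_erase_of_blocked symm cut hC hs K.card x hxC hxt ⟨y, hyC, hxy⟩ K hK hKne
    htK ?_ le_rfl
  intro z hz w hw hwx hzw
  by_contra hwK
  exact hcl z hz w (Finset.mem_erase.2 ⟨hwx, hw⟩) hwK hzw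

/-- Vertices are peeled off `C` one at a time, in increasing order. The value `0` stands for
everything outside `C`, and `C` stays linked to `t` so that each peeled vertex keeps a higher
neighbour. -/
theorem exists_numbering_of_linkedTo {r : W → W → Prop} (symm : ∀ x y, r x y → r y x) {s t : W}
    (cut : NoCutVertex r s t) (n : ℕ) :
    ∀ C : Finset W, C.card = n → LinkedTo r t C → s ∉ C → t ∈ C →
      ∃ f : W → ℕ, (∀ x, x ∉ C → f x = 0) ∧ (∀ x ∈ C, 0 < f x) ∧ Set.InjOn f C ∧
        ∀ x ∈ C, x ≠ t → (∃ y, r x y ∧ f y < f x) ∧ ∃ y, r x y ∧ f x < f y := by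
  induction n with
  | zero =>
    intro C hcard _ _ ht
    simp [Finset.card_eq_zero.1 hcard] at ht
  | succ n ih =>
    intro C hcard hC hs ht
    by_cases hne : (C.erase t).Nonempty
    · obtain ⟨u, hu, hut, ⟨y, hyC, huy⟩, hlink⟩ := exists_linkedTo_erase symm cut hC hs hne
      obtain ⟨f, hf0, hfpos, hinj, hf⟩ := ih (C.erase u) (by rw [Finset.card_erase_of_mem hu]; omega)
        hlink (fun h => hs (Finset.mem_of_mem_erase h)) (Finset.mem_erase.2 ⟨hut.symm, ht⟩)
      have hfu : f u = 0 := hf0 u (Finset.notMem_erase u C)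
      -- Shifting by one gives `u` the number `1`, above the outside of `C` and below the rest of
      -- `C`.
      refine ⟨fun x => if x ∈ C then f x + 1 else 0, fun x hx => if_neg hx,
        fun x hx => by simp [hx], ?_, ?_⟩
      · intro a ha b hb hab
        have ha' : a ∈ C := ha
        have hb' : b ∈ C := hb
        simp only [ha', hb', if_true, add_left_inj] at hab
        by_cases hau : a = u
        · by_contra hne
          have := hfpos b (Finset.mem_erase.2 ⟨fun h => hne (hau.trans h.symm), hb'⟩)
          rw [← hab, hau, hfu] at this
          exact lt_irrefl _ this
        · by_cases hbu : b = u
          · have := hfpos a (Finset.mem_erase.2 ⟨hau, ha'⟩)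
            rw [hab, hbu, hfu] at this
            exact absurd this (lt_irrefl _)
          · exact hinj (by simp [hau, ha']) (by simp [hbu, hb']) hab
      · intro x hx hxt
        by_cases hxu : x = u
        · subst hxu
          refine ⟨⟨y, huy, by simp [hx, hyC]⟩, ?_⟩
          -- Linkedness of the singleton provides the higher neighbour.
          obtain ⟨a, ha, b, hb, hbn, hab⟩ := hC {x} (by simpa using hx) (by simp)
            (by simpa using hxt.symm)
          obtain rfl := Finset.mem_singleton.1 ha
          have hbpos := hfpos b (Finset.mem_erase.2 ⟨by simpa using hbn, hb⟩)
          exact ⟨b, hab, by simp only [hx, hb, if_true]; omega⟩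
        · obtain ⟨⟨a, hxa, ha⟩, b, hxb, hb⟩ := hf x (Finset.mem_erase.2 ⟨hxu, hx⟩) hxt
          have hbC : b ∈ C := by
            by_contra hbC
            rw [hf0 b (fun h => hbC (Finset.mem_of_mem_erase h))] at hb
            omega
          refine ⟨⟨a, hxa, ?_⟩, b, hxb, by simp only [hx, hbC, if_true]; omega⟩
          simp only [hx, if_true]
          split_ifs <;> omega
    · have hCt : ∀ x ∈ C, x = t := by
        intro x hx
        by_contra hxt
        exact hne ⟨x, Finset.mem_erase.2 ⟨hxt, hx⟩⟩
      exact ⟨fun x => if x ∈ C then 1 else 0, fun x hx => if_neg hx, fun x hx => by simp [hx],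
        fun a ha b hb _ => (hCt a ha).trans (hCt b hb).symm, fun x hx hxt => absurd (hCt x hx) hxt⟩

/-- A finite graph with two terminals and without cut vertices has a bipolar numbering: an injective
numbering for which every vertex but the terminals has a lower and a higher neighbour. -/
theorem exists_bipolar_numbering [Fintype W] {r : W → W → Prop} (symm : ∀ x y, r x y → r y x)
    {s t : W} (hst : s ≠ t) (cut : NoCutVertex r s t) :
    ∃ f : W → ℕ, Function.Injective f ∧
      ∀ x, x ≠ s → x ≠ t → (∃ y, r x y ∧ f y < f x) ∧ ∃ y, r x y ∧ f x < f y := by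
  have hlink : LinkedTo r t (Finset.univ.erase s) := by
    intro K hK hne htK
    have hsK : s ∉ K := fun h => (Finset.mem_erase.1 (hK h)).1 rfl
    -- Taking the terminal `s` itself as the excluded vertex keeps the edge inside the complement of
    -- `s`.
    obtain ⟨x, hx, y, hyK, hys, hxy⟩ := cut K hne hsK htK s hsK
    exact ⟨x, hx, y, by simp [hys], hyK, hxy⟩
  obtain ⟨f, hf0, hfpos, hinj, hf⟩ := exists_numbering_of_linkedTo symm cut _ _ rfl hlink
    (by simp) (by simp [hst.symm])
  refine ⟨f, ?_, fun x hxs hxt => hf x (by simp [hxs]) hxt⟩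
  have hs0 : f s = 0 := hf0 s (by simp)
  intro a b hab
  by_cases ha : a = s
  · by_contra hne
    have := hfpos b (by simpa using fun h => hne (ha.trans h.symm))
    rw [← hab, ha, hs0] at this
    exact lt_irrefl _ this
  · by_cases hb : b = s
    · have := hfpos a (by simpa using ha)
      rw [hab, hb, hs0] at this
      exact absurd this (lt_irrefl _)
    · exact hinj (by simpa using ha) (by simpa using hb) hab

end BipolarNumbering

/-! ### Absence of cut vertices in regular bipartite graphs. -/

theorem card_filter_map_fst {A : Type*} [Fintype A] [DecidableEq A] (m : ℕ)
    (K : Finset (Option A)) (hK : none ∉ K) :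
    (Finset.univ.filter fun x : Option (A × Fin m) => x.map Prod.fst ∈ K).card = K.card * m := by
  classical
  rw [Finset.card_eq_sum_card_fiberwise (f := fun x : Option (A × Fin m) => x.map Prod.fst) (t := K)
    (fun x hx => by simpa using hx), Finset.sum_const_nat]
  intro a ha
  obtain _ | a := a
  · exact absurd ha hK
  calc _ = (Finset.univ.image fun i : Fin m => some (a, i)).card := by
        congr 1
        ext x
        obtain _ | ⟨b, i⟩ := x
        · simp
        · simp only [Finset.mem_filter, Finset.mem_univ, true_and, Option.map_some,
            Option.some.injEq, Finset.mem_image, Prod.mk.injEq]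
          exact ⟨fun h => ⟨i, h.2.symm, rfl⟩, fun ⟨_, h, _⟩ => ⟨h ▸ ha, h.symm⟩⟩
    _ = m := by
        rw [Finset.card_image_of_injective _ fun i j h => by simpa using h, Finset.card_fin]

/-- In an `m`-regular bipartite graph with one additional half edge on either side, a set of vertices
whose half edges all lead into the set or to the single vertex `a₀` is closed, or it contains all the
neighbours of `a₀`. -/
theorem closed_or_absorbs {A B : Type*} [Fintype A] [Fintype B] [DecidableEq A] [DecidableEq B]
    {m : ℕ} (hm : 2 ≤ m) (e : Option (A × Fin m) ≃ Option (B × Fin m))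
    (KA : Finset (Option A)) (KB : Finset (Option B)) (hKA : none ∉ KA) (hKB : none ∉ KB)
    (a₀ : Option A) (ha₀ : a₀ ∉ KA)
    (hA : ∀ x, x.map Prod.fst ∈ KA → (e x).map Prod.fst ∈ KB)
    (hB : ∀ x, (e x).map Prod.fst ∈ KB → x.map Prod.fst ∈ KA ∨ x.map Prod.fst = a₀) :
    (∀ x, (e x).map Prod.fst ∈ KB → x.map Prod.fst ∈ KA) ∨
      (a₀ ≠ none ∧ ∀ x, x.map Prod.fst = a₀ → (e x).map Prod.fst ∈ KB) := by
  classical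
  set HA := Finset.univ.filter fun x : Option (A × Fin m) => x.map Prod.fst ∈ KA with hHA
  set HB := Finset.univ.filter fun x : Option (A × Fin m) => (e x).map Prod.fst ∈ KB with hHB
  have cA : HA.card = KA.card * m := card_filter_map_fst m KA hKA
  have cB : HB.card = KB.card * m := by
    rw [← card_filter_map_fst m KB hKB]
    refine Finset.card_bij (fun x _ => e x) (fun x hx => by simpa [hHB] using hx)
      (fun _ _ _ _ h => e.injective h) fun y hy => ⟨e.symm y, by simpa [hHB] using hy, by simp⟩
  have hsub : HA ⊆ HB := fun x hx => by
    simp only [hHA, hHB, Finset.mem_filter, Finset.mem_univ, true_and] at hx ⊢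
    exact hA x hx
  -- The edges from `KB` that miss `KA` all end at `a₀`. Their number is a multiple of `m`, so it is
  -- zero or accounts for all `m` half edges of `a₀`.
  have hdvd : m ∣ (HB \ HA).card := by
    rw [Finset.card_sdiff_of_subset hsub, cA, cB]
    exact Nat.dvd_sub (Dvd.intro_left _ rfl) (Dvd.intro_left _ rfl)
  have hJ : ∀ x ∈ HB \ HA, x.map Prod.fst = a₀ := by
    intro x hx
    simp only [hHA, hHB, Finset.mem_sdiff, Finset.mem_filter, Finset.mem_univ, true_and] at hx
    exact (hB x hx.1).resolve_left hx.2
  by_cases hzero : HB \ HA = ∅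
  · left
    intro x hx
    by_contra hxA
    have : x ∈ HB \ HA := by simp [hHA, hHB, hx, hxA]
    simp [hzero] at this
  right
  have hpos : m ≤ (HB \ HA).card :=
    Nat.le_of_dvd (Finset.card_pos.2 (Finset.nonempty_iff_ne_empty.2 hzero)) hdvd
  -- The terminal carries a single half edge, fewer than `m`.
  have hnone : a₀ ≠ none := by
    rintro rfl
    have : (HB \ HA).card ≤ 1 := Finset.card_le_one.2 fun x hx y hy => by
      rw [Option.map_eq_none_iff.1 (hJ x hx), Option.map_eq_none_iff.1 (hJ y hy)]
    omega
  refine ⟨hnone, fun x hx => ?_⟩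
  have hV : HB \ HA = Finset.univ.filter fun x : Option (A × Fin m) => x.map Prod.fst ∈
      ({a₀} : Finset (Option A)) := by
    refine Finset.eq_of_subset_of_card_le (fun y hy => by simp [hJ y hy]) ?_
    rw [card_filter_map_fst m {a₀} (by simpa using hnone.symm)]
    simpa using hpos
  have hx' : x ∈ HB \ HA := by rw [hV]; simpa using hx
  simpa [hHB] using (Finset.mem_sdiff.1 hx').1

namespace FeynmanGraph

variable {D : ℕ} (G : FeynmanGraph D)

/-- The vertices together with the two ends of the insertion, which are the two terminals. -/
abbrev OpenNode : Type := Option (Fin G.numT) ⊕ Option (Fin G.numP)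

/-- The open node of a tensor `T`. -/
abbrev endT (h : G.HalfT) : G.OpenNode := Sum.inl (h.map Prod.fst)

/-- The open node of a tensor `P`. -/
abbrev endP (h : G.HalfP) : G.OpenNode := Sum.inr (h.map Prod.fst)

/-- Adjacency of open nodes: the graph is cut open at the insertion. -/
def OpenAdj (x y : G.OpenNode) : Prop :=
  ∃ h : G.HalfT, x = G.endT h ∧ y = G.endP (G.pairing h) ∨
    y = G.endT h ∧ x = G.endP (G.pairing h)

variable {G}

theorem OpenAdj.symm {x y : G.OpenNode} (h : G.OpenAdj x y) : G.OpenAdj y x := by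
  obtain ⟨h, hxy | hxy⟩ := h
  exacts [⟨h, Or.inr hxy⟩, ⟨h, Or.inl hxy⟩]

/-- In a connected graph no nonempty set of vertices is closed under adjacency. -/
theorem Connected.eq_empty_of_closed (hG : G.Connected) (L : Finset G.OpenNode)
    (hs : Sum.inl none ∉ L) (ht : Sum.inr none ∉ L)
    (hL : ∀ h, G.endT h ∈ L ↔ G.endP (G.pairing h) ∈ L) : L = ∅ := by
  -- Both terminals become the one node `none` when the insertion is closed up; `p` fails there, so
  -- no walk to `none` can start in `L`.
  let p : G.Node → Prop := fun n => match n with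
    | none => False
    | some (Sum.inl a) => Sum.inl (some a) ∈ L
    | some (Sum.inr b) => Sum.inr (some b) ∈ L
  have pT : ∀ h, p (G.nodeT h) ↔ G.endT h ∈ L := by
    rintro (_ | ⟨a, i⟩)
    · exact ⟨fun h => h.elim, fun h => hs h⟩
    · rfl
  have pP : ∀ h, p (G.nodeP h) ↔ G.endP h ∈ L := by
    rintro (_ | ⟨a, i⟩)
    · exact ⟨fun h => h.elim, fun h => ht h⟩
    · rfl
  have hedge : ∀ h, p (G.nodeT h) ↔ p (G.nodeP (G.pairing h)) := fun h => by
    rw [pT, pP, hL]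
  have hno : ∀ n, ¬ p n := by
    intro n hn
    have hwalk : ∀ {m m'}, (SimpleGraph.fromRel fun x y : G.Node =>
        ∃ h : G.HalfT, x = G.nodeT h ∧ y = G.nodeP (G.pairing h)).Walk m m' → p m → p m' := by
      intro m m' w hm
      induction w with
      | nil => exact hm
      | cons hadj _ ih =>
        refine ih ?_
        rw [SimpleGraph.fromRel_adj] at hadj
        obtain ⟨-, ⟨h, rfl, rfl⟩ | ⟨h, rfl, rfl⟩⟩ := hadj
        exacts [(hedge h).1 hm, (hedge h).2 hm]
    obtain ⟨w⟩ := hG.preconnected n none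
    exact hwalk w hn
  refine Finset.eq_empty_of_forall_notMem ?_
  rintro ((_ | a) | (_ | b)) hx
  · exact hs hx
  · exact hno (some (Sum.inl a)) hx
  · exact ht hx
  · exact hno (some (Sum.inr b)) hx

/-- A connected graph, cut open at the insertion, has no cut vertex: it is bipartite and regular. -/
theorem Connected.noCutVertex (hD : 1 ≤ D) (hG : G.Connected) :
    NoCutVertex G.OpenAdj (Sum.inl none) (Sum.inr none) := by
  intro K hne hs ht v hv
  by_contra hcon
  push Not at hcon
  have hTP : ∀ h, G.endT h ∈ K → G.endP (G.pairing h) ∈ K ∨ G.endP (G.pairing h) = v := by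
    intro h hh
    by_contra! hn
    exact hcon _ hh _ hn.1 hn.2 ⟨h, Or.inl ⟨rfl, rfl⟩⟩
  have hPT : ∀ h, G.endP (G.pairing h) ∈ K → G.endT h ∈ K ∨ G.endT h = v := by
    intro h hh
    by_contra! hn
    exact hcon _ hh _ hn.1 hn.2 ⟨h, Or.inr ⟨rfl, rfl⟩⟩
  let KT : Finset (Option (Fin G.numT)) := Finset.univ.filter fun a => Sum.inl a ∈ K
  let KP : Finset (Option (Fin G.numP)) := Finset.univ.filter fun b => Sum.inr b ∈ K
  have memT : ∀ a, a ∈ KT ↔ Sum.inl a ∈ K := fun a => by simp [KT]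
  have memP : ∀ a, a ∈ KP ↔ Sum.inr a ∈ K := fun a => by simp [KP]
  have hdone : (∀ h, G.endT h ∈ K ↔ G.endP (G.pairing h) ∈ K) → False := fun h =>
    hne.ne_empty (hG.eq_empty_of_closed K hs ht h)
  -- When `K` absorbs all the neighbours of `v`, the closed set contradicting connectedness is
  -- `insert v K`.
  have hdone' : v ≠ Sum.inl none → v ≠ Sum.inr none →
      (∀ h, G.endT h ∈ insert v K ↔ G.endP (G.pairing h) ∈ insert v K) → False := by
    intro h1 h2 h
    have := hG.eq_empty_of_closed (insert v K) (by simp [h1.symm, hs]) (by simp [h2.symm, ht]) h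
    simp at this
  obtain a₀ | b₀ := v
  · have hTP' : ∀ h, G.endT h ∈ K → G.endP (G.pairing h) ∈ K := fun h hh =>
      (hTP h hh).resolve_right (by simp)
    rcases closed_or_absorbs (by omega : 2 ≤ D + 1) G.pairing KT KP (by rwa [memT]) (by rwa [memP])
      a₀ (by rwa [memT]) (by simpa only [memT, memP] using hTP')
      (by simpa only [memT, memP, endT, Sum.inl.injEq] using hPT) with h | ⟨hn, h⟩
    · simp only [memT, memP] at h
      exact hdone fun x => ⟨hTP' x, h x⟩
    · simp only [memP] at h
      refine hdone' (by simpa using hn) (by simp) fun x => ?_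
      simp only [Finset.mem_insert, reduceCtorEq, false_or]
      refine ⟨?_, fun hx => (hPT x hx).symm⟩
      rintro (hx | hx)
      · exact h x (Sum.inl.inj hx)
      · exact hTP' x hx
  · have hPT' : ∀ h, G.endP (G.pairing h) ∈ K → G.endT h ∈ K := fun h hh =>
      (hPT h hh).resolve_right (by simp)
    have key := closed_or_absorbs (by omega : 2 ≤ D + 1) G.pairing.symm KP KT (by rwa [memP])
      (by rwa [memT]) b₀ (by rwa [memP])
      (fun x hx => by
        rw [memT]; exact hPT' _ (by rw [memP] at hx; simpa using hx))
      (fun x hx => by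
        rw [memT] at hx
        simpa [memP] using hTP _ hx)
    rcases key with h | ⟨hn, h⟩
    · simp only [memT, memP] at h
      exact hdone fun x => ⟨fun hx => h (G.pairing x) (by simpa using hx), hPT' x⟩
    · simp only [memT] at h
      refine hdone' (by simp) (by simpa using hn) fun x => ?_
      simp only [Finset.mem_insert, reduceCtorEq, false_or]
      refine ⟨fun hx => (hTP x hx).symm, ?_⟩
      rintro (hx | hx)
      · simpa using h (G.pairing x) (Sum.inr.inj hx)
      · exact hPT' x hx

end FeynmanGraph

/-! ### Counting faces by their extremal corners. -/

theorem Fin.add_succ_add_rev_succ {D : ℕ} (i : Fin (D + 1)) (k : Fin D) :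
    i + k.succ + k.rev.succ = i := by
  have : k.succ + k.rev.succ = 0 := by
    ext
    simp only [Fin.val_add, Fin.val_succ, Fin.val_rev, Fin.val_zero]
    rw [show (k : ℕ) + 1 + (D - (k + 1) + 1) = D + 1 by omega, Nat.mod_self]
  rw [add_assoc, this, add_zero]

theorem card_corners_le {D : ℕ} (u : Fin (D + 1) → Prop) [DecidablePred u] :
    (Finset.univ.filter fun p : Fin (D + 1) × Fin D => u p.1 ∧ u (p.1 + p.2.succ)).card ≤
      (Finset.univ.filter u).card * (Finset.univ.filter u).card - (Finset.univ.filter u).card := by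
  rw [← Finset.offDiag_card]
  refine Finset.card_le_card_of_injOn (fun p => (p.1, p.1 + p.2.succ)) ?_ ?_
  · intro p hp
    simpa [Fin.succ_ne_zero] using hp
  · rintro ⟨i, k⟩ - ⟨j, l⟩ - h
    obtain ⟨rfl, h⟩ := Prod.mk.inj h
    simpa using h

namespace FeynmanGraph

variable {D : ℕ} (G : FeynmanGraph D)

/-- The interaction vertices. -/
abbrev Vertex : Type := Fin G.numT ⊕ Fin G.numP

/-- The corners of the interaction vertices, each with one of its two orientations: the corner of the
vertex `u` from its tensor `i` to its tensor `i + k.succ`. -/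
abbrev Corner : Type := G.Vertex × Fin (D + 1) × Fin D

variable {G}

/-- The open node of a vertex. -/
def Vertex.node : G.Vertex → G.OpenNode
  | Sum.inl v => Sum.inl (some v)
  | Sum.inr v => Sum.inr (some v)

/-- The open node on the other side of the propagator of a tensor. -/
def Vertex.neighbor : G.Vertex → Fin (D + 1) → G.OpenNode
  | Sum.inl v, i => G.endP (G.pairing (some (v, i)))
  | Sum.inr v, i => G.endT (G.pairing.symm (some (v, i)))

/-- The first index of an oriented corner. -/
def Corner.index : G.Corner → G.Index
  | (Sum.inl v, i, k) => Sum.inl (some (v, i), k)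
  | (Sum.inr v, i, k) => Sum.inr (some (v, i), k)

/-- The opposite orientation of a corner. -/
def Corner.flip (c : G.Corner) : G.Corner := (c.1, c.2.1 + c.2.2.succ, c.2.2.rev)

/-- The open node of an index. -/
def indexNode : G.Index → G.OpenNode
  | Sum.inl (h, _) => G.endT h
  | Sum.inr (h, _) => G.endP h

/-- The face through an index. -/
def face (x : G.Index) : G.Face := Quot.mk _ x

theorem face_flip (c : G.Corner) : G.face c.flip.index = G.face c.index := by
  obtain ⟨v | v, i, k⟩ := c
  · exact (Quot.sound (Glued.vertexT v i k)).symm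
  · exact (Quot.sound (Glued.vertexP v i k)).symm

theorem indexNode_index (c : G.Corner) : indexNode c.index = Vertex.node c.1 := by
  obtain ⟨v | v, i, k⟩ := c <;> rfl

theorem exists_face_eq_neighbor (c : G.Corner) :
    ∃ y : G.Index, G.face y = G.face c.index ∧ indexNode y = Vertex.neighbor c.1 c.2.1 := by
  obtain ⟨v | v, i, k⟩ := c
  · exact ⟨_, (Quot.sound (Glued.propagator (some (v, i)) k)).symm, rfl⟩
  · refine ⟨Sum.inl (G.pairing.symm (some (v, i)),
      (G.strand (G.pairing.symm (some (v, i)))).symm k), ?_, rfl⟩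
    have := Quot.sound (Glued.propagator (G := G) (G.pairing.symm (some (v, i)))
      ((G.strand (G.pairing.symm (some (v, i)))).symm k))
    rw [Equiv.apply_symm_apply, Equiv.apply_symm_apply] at this
    exact this

theorem neighbor_ne_node (u : G.Vertex) (i : Fin (D + 1)) : Vertex.neighbor u i ≠ Vertex.node u := by
  obtain v | v := u <;> simp [Vertex.neighbor, Vertex.node]

open Classical in
/-- The tensors of a vertex that are joined to lower vertices, for the numbering `f`. -/
def lowerHalves (f : G.OpenNode → ℤ) (u : G.Vertex) : Finset (Fin (D + 1)) :=
  Finset.univ.filter fun i => f (Vertex.neighbor u i) < f (Vertex.node u)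

/-- The oriented corners that are local maxima of a face, for the numbering `f`. -/
def peaks (f : G.OpenNode → ℤ) : Finset G.Corner :=
  Finset.univ.filter fun c => c.2.1 ∈ lowerHalves f c.1 ∧ c.flip.2.1 ∈ lowerHalves f c.1

theorem card_peaks_le (f : G.OpenNode → ℤ) :
    (peaks f).card ≤
      ∑ u : G.Vertex, ((lowerHalves f u).card * (lowerHalves f u).card - (lowerHalves f u).card) := by
  rw [Finset.card_eq_sum_card_fiberwise (f := Prod.fst) (t := Finset.univ) fun _ _ => by simp]
  refine Finset.sum_le_sum fun u _ => ?_
  have h := card_corners_le fun i => i ∈ lowerHalves f u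
  simp only [Finset.filter_univ_mem] at h
  refine le_trans ?_ h
  refine Finset.card_le_card_of_injOn Prod.snd ?_ ?_
  · rintro ⟨w, i, k⟩ hc
    simp only [peaks, Finset.coe_filter, Finset.mem_filter, Finset.mem_univ, true_and,
      Set.mem_ofPred_eq] at hc ⊢
    obtain ⟨hc, rfl⟩ := hc
    exact hc
  · rintro ⟨w, p⟩ hc ⟨w', p'⟩ hc' h
    simp only [Finset.coe_filter, Set.mem_ofPred_eq] at hc hc' h
    exact Prod.ext (hc.2.trans hc'.2.symm) h

/-- A face that avoids the insertion has a corner that is a local maximum. -/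
theorem exists_peak {f : G.OpenNode → ℤ} (hf : Function.Injective f) (φ : G.Face)
    (hφ : ∀ k, G.face (Sum.inl (none, k)) ≠ φ) : ∃ c ∈ peaks f, G.face c.index = φ := by
  have hne : {x : G.Index | G.face x = φ}.Nonempty := Quot.exists_rep φ
  obtain ⟨x, hx, hmax⟩ := Set.exists_max_image _ (fun x => f (indexNode x)) (Set.toFinite _) hne
  have hx : G.face x = φ := hx
  obtain ⟨c, rfl⟩ : ∃ c : G.Corner, c.index = x := by
    obtain ⟨_ | ⟨v, i⟩, k⟩ | ⟨_ | ⟨v, i⟩, k⟩ := x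
    · exact absurd hx (hφ k)
    · exact ⟨(Sum.inl v, i, k), rfl⟩
    · exact absurd ((Quot.sound (Glued.insertion k)).trans hx) (hφ k)
    · exact ⟨(Sum.inr v, i, k), rfl⟩
  -- The face continues along the propagator to a neighbour that cannot be higher; injectivity and
  -- bipartiteness exclude equality.
  have hlower : ∀ d : G.Corner, G.face d.index = φ → d.1 = c.1 → d.2.1 ∈ lowerHalves f d.1 := by
    intro d hd hdc
    obtain ⟨y, hy, hyn⟩ := exists_face_eq_neighbor d
    have := hmax y (hy.trans hd)
    simp only [hyn, indexNode_index, ← hdc] at this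
    simpa [lowerHalves] using lt_of_le_of_ne this fun h => neighbor_ne_node _ _ (hf h)
  refine ⟨c, ?_, hx⟩
  simp only [peaks, Finset.mem_filter, Finset.mem_univ, true_and]
  exact ⟨hlower c hx rfl, hlower c.flip ((face_flip c).trans hx) rfl⟩

theorem flip_mem_peaks {f : G.OpenNode → ℤ} {c : G.Corner} (hc : c ∈ peaks f) :
    c.flip ∈ peaks f := by
  simp only [peaks, Finset.mem_filter, Finset.mem_univ, true_and] at hc ⊢
  refine ⟨hc.2, ?_⟩
  have : c.flip.flip.2.1 = c.2.1 := Fin.add_succ_add_rev_succ _ _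
  rw [this]
  exact hc.1

theorem flip_ne (c : G.Corner) : c.flip ≠ c := by
  intro h
  have : c.2.1 + c.2.2.succ = c.2.1 := congrArg (fun d : G.Corner => d.2.1) h
  simp [Fin.succ_ne_zero] at this

instance : Finite G.Face := inferInstanceAs (Finite (Quot _))

/-- The factor `2` comes from the two orientations of a peak, which are distinct and lie on the same
face. -/
theorem two_mul_card_le_card_peaks [DecidableEq G.Face] {f : G.OpenNode → ℤ}
    (hf : Function.Injective f) (U : Finset G.Face)
    (hU : ∀ φ ∈ U, ∀ k, G.face (Sum.inl (none, k)) ≠ φ) : 2 * U.card ≤ (peaks f).card := by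
  calc 2 * U.card = ∑ _φ ∈ U, 2 := by rw [Finset.sum_const, smul_eq_mul, mul_comm]
    _ ≤ ∑ φ ∈ U, ((peaks f).filter fun c => G.face c.index = φ).card := by
        refine Finset.sum_le_sum fun φ hφ => ?_
        obtain ⟨c, hc, hcφ⟩ := exists_peak hf φ (hU φ hφ)
        refine Finset.one_lt_card.2 ⟨c, by simp [hc, hcφ], c.flip, ?_, (flip_ne c).symm⟩
        simp [flip_mem_peaks hc, face_flip, hcφ]
    _ ≤ (peaks f).card := by
        rw [Finset.sum_card_fiberwise_eq_card_filter]
        exact Finset.card_filter_le _ _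

theorem exists_neighbor_of_openAdj {u : G.Vertex} {y : G.OpenNode} (h : G.OpenAdj u.node y) :
    ∃ i, Vertex.neighbor u i = y := by
  obtain v | v := u
  · obtain ⟨_ | ⟨a, i⟩, ⟨hv, hy⟩ | ⟨hy, hv⟩⟩ := h <;> simp [Vertex.node] at hv
    subst hv
    exact ⟨i, hy.symm⟩
  · obtain ⟨h, ⟨hv, hy⟩ | ⟨hy, hv⟩⟩ := h <;> simp only [Vertex.node, reduceCtorEq] at hv
    obtain ⟨⟨b, i⟩, hb, rfl⟩ := Option.map_eq_some_iff.1 (Sum.inr.inj hv).symm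
    refine ⟨i, ?_⟩
    rw [hy]
    simp [Vertex.neighbor, ← hb]

theorem Connected.four_mul_card_le (hD : 1 ≤ D) (hG : G.Connected) (U : Finset G.Face)
    (hU : ∀ φ ∈ U, ∀ k, G.face (Sum.inl (none, k)) ≠ φ) :
    4 * U.card ≤ G.numVertices * (D * (D - 1)) := by
  classical
  obtain ⟨f₀, hinj, hf₀⟩ := exists_bipolar_numbering (fun _ _ => OpenAdj.symm)
    (by simp) (hG.noCutVertex hD)
  let f : G.OpenNode → ℤ := fun x => f₀ x
  have hf : Function.Injective f := fun x y h => hinj (by simpa [f] using h)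
  -- The peaks of `-f` are the local minima for `f`.
  have hg : Function.Injective (fun x => -f x) := fun x y h => hf (by simpa using h)
  have h₁ := (two_mul_card_le_card_peaks hf U hU).trans (card_peaks_le f)
  have h₂ := (two_mul_card_le_card_peaks hg U hU).trans (card_peaks_le fun x => -f x)
  have hsum : ∀ u : G.Vertex,
      ((lowerHalves f u).card * (lowerHalves f u).card - (lowerHalves f u).card) +
        ((lowerHalves (fun x => -f x) u).card * (lowerHalves (fun x => -f x) u).card -
          (lowerHalves (fun x => -f x) u).card) ≤ D * (D - 1) := by
    intro u
    obtain ⟨⟨y, hy, hlt⟩, z, hz, hlt'⟩ := hf₀ u.node (by cases u <;> simp [Vertex.node])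
      (by cases u <;> simp [Vertex.node])
    obtain ⟨i, rfl⟩ := exists_neighbor_of_openAdj hy
    obtain ⟨j, rfl⟩ := exists_neighbor_of_openAdj hz
    have hs : 0 < (lowerHalves f u).card :=
      Finset.card_pos.2 ⟨i, by simpa [lowerHalves, f] using hlt⟩
    have ht : 0 < (lowerHalves (fun x => -f x) u).card :=
      Finset.card_pos.2 ⟨j, by simpa [lowerHalves, f] using hlt'⟩
    have hst : (lowerHalves f u).card + (lowerHalves (fun x => -f x) u).card ≤ D + 1 := by
      rw [← Finset.card_union_of_disjoint]
      · simpa using Finset.card_le_univ (lowerHalves f u ∪ lowerHalves (fun x => -f x) u)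
      · rw [Finset.disjoint_left]
        intro i hi hi'
        simp only [lowerHalves, Finset.mem_filter, Finset.mem_univ, true_and] at hi hi'
        omega
    obtain ⟨a, ha⟩ := Nat.exists_eq_add_of_lt hs
    obtain ⟨b, hb⟩ := Nat.exists_eq_add_of_lt ht
    obtain ⟨c, hc⟩ := Nat.exists_eq_add_of_le hst
    obtain ⟨e, rfl⟩ : ∃ e, D = e + 1 := ⟨D - 1, by omega⟩
    obtain rfl : e = a + b + c := by omega
    simp only [ha, hb, zero_add, Nat.add_sub_cancel]
    rw [← Nat.sub_one_mul, ← Nat.sub_one_mul, Nat.add_sub_cancel, Nat.add_sub_cancel]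
    -- With `a + 1` lower and `b + 1` higher half edges and `D = a + b + c + 1`, the right side
    -- exceeds the left by `2ab + 2ac + 2bc + c² + c`.
    nlinarith [Nat.zero_le (a * b), Nat.zero_le (a * c), Nat.zero_le (b * c), Nat.zero_le (c * c)]
  calc 4 * U.card = 2 * U.card + 2 * U.card := by ring
    _ ≤ _ := add_le_add h₁ h₂
    _ ≤ ∑ _u : G.Vertex, D * (D - 1) := by
        rw [← Finset.sum_add_distrib]
        exact Finset.sum_le_sum fun u _ => hsum u
    _ = G.numVertices * (D * (D - 1)) := by simp [numVertices]

theorem Connected.four_mul_numFaces_le (hD : 1 ≤ D) (hG : G.Connected) :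
    4 * G.numFaces ≤ 4 * D + G.numVertices * (D * (D - 1)) := by
  classical
  have := Fintype.ofFinite G.Face
  -- The faces through the insertion, at most one for each of its `D` strands.
  let M : Finset G.Face := Finset.univ.image fun k => G.face (Sum.inl (none, k))
  have hM : M.card ≤ D := Finset.card_image_le.trans (Finset.card_fin D).le
  have hU := hG.four_mul_card_le hD Mᶜ fun φ hφ k h => by
    simp only [M, Finset.mem_compl, Finset.mem_image, Finset.mem_univ, true_and] at hφ
    exact hφ ⟨k, h⟩
  have hcard : G.numFaces = M.card + Mᶜ.card := by
    rw [numFaces, Nat.card_eq_fintype_card, Finset.card_add_card_compl]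
  omega

theorem Connected.degree_nonneg (hD : 1 ≤ D) (hG : G.Connected) : 0 ≤ G.degree := by
  have h : (4 * G.numFaces : ℝ) ≤ 4 * D + G.numVertices * (D * (D - 1)) := by
    have := hG.four_mul_numFaces_le hD
    have h' : ((4 * G.numFaces : ℕ) : ℝ) ≤ ((4 * D + G.numVertices * (D * (D - 1)) : ℕ) : ℝ) := by
      exact_mod_cast this
    push_cast [Nat.cast_sub hD] at h'
    exact h'
  unfold degree
  linarith

end FeynmanGraph

/-! ### Amplitudes and the ring graph. -/

namespace FeynmanGraph

variable {D : ℕ} {G : FeynmanGraph D}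

/-- Reversing a corner exchanges `i < j` and `j < i`, so the deltas with `i < j` already impose all
the contractions. -/
theorem vertexKernel_eq_ite {N : ℕ} (a : Fin (D + 1) → Fin D → Fin N) [Decidable
    (∀ i k, a i k = a (i + k.succ) k.rev)] :
    vertexKernel a = if ∀ i k, a i k = a (i + k.succ) k.rev then 1 else 0 := by
  have key : (∀ p ∈ (Finset.univ : Finset (Fin (D + 1) × Fin D)).filter
      (fun p => p.1 < p.1 + p.2.succ), a p.1 p.2 = a (p.1 + p.2.succ) p.2.rev) ↔
      ∀ i k, a i k = a (i + k.succ) k.rev := by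
    refine ⟨fun h i k => ?_, fun h p _ => h p.1 p.2⟩
    rcases lt_or_ge i (i + k.succ) with hlt | hge
    · exact h (i, k) (by simpa using hlt)
    · have hne : i + k.succ ≠ i := by simp [Fin.succ_ne_zero]
      have := h (i + k.succ, k.rev) (by
        simp only [Finset.mem_filter, Finset.mem_univ, true_and, Fin.add_succ_add_rev_succ]
        exact lt_of_le_of_ne hge hne)
      simp only [Fin.add_succ_add_rev_succ, Fin.rev_rev] at this
      exact this.symm
  unfold vertexKernel delta
  rw [Finset.prod_boole]
  by_cases h : ∀ i k, a i k = a (i + k.succ) k.rev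
  · rw [if_pos h, if_pos (key.2 h)]
  · rw [if_neg h, if_neg (mt key.1 h)]

/-- The index assignments that are compatible with all the Kronecker deltas of the graph. -/
def Compatible (G : FeynmanGraph D) {N : ℕ}
    (x : (G.HalfT → Fin D → Fin N) × (G.HalfP → Fin D → Fin N)) : Prop :=
  (∀ k, x.1 none k = x.2 none k) ∧
  (∀ v i k, x.1 (some (v, i)) k = x.1 (some (v, i + k.succ)) k.rev) ∧
  (∀ v i k, x.2 (some (v, i)) k = x.2 (some (v, i + k.succ)) k.rev) ∧
  ∀ h k, x.1 h k = x.2 (G.pairing h) (G.strand h k)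

/-- Compatible index assignments are constant along the faces. -/
def compatibleEquiv (G : FeynmanGraph D) (N : ℕ) :
    {x : (G.HalfT → Fin D → Fin N) × (G.HalfP → Fin D → Fin N) // G.Compatible x} ≃
      (G.Face → Fin N) where
  toFun x := Quot.lift (Sum.elim (fun p => x.1.1 p.1 p.2) (fun p => x.1.2 p.1 p.2)) (by
    rintro _ _ (⟨h, k⟩ | k | ⟨v, i, k⟩ | ⟨v, i, k⟩)
    exacts [x.2.2.2.2 h k, x.2.1 k, x.2.2.1 v i k, x.2.2.2.1 v i k])
  invFun c := ⟨(fun h k => c (G.face (Sum.inl (h, k))), fun h k => c (G.face (Sum.inr (h, k)))),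
    fun k => congrArg c (Quot.sound (Glued.insertion k)),
    fun v i k => congrArg c (Quot.sound (Glued.vertexT v i k)),
    fun v i k => congrArg c (Quot.sound (Glued.vertexP v i k)),
    fun h k => congrArg c (Quot.sound (Glued.propagator h k))⟩
  left_inv _ := rfl
  right_inv c := by
    funext φ
    obtain ⟨⟨h, k⟩ | ⟨h, k⟩⟩ := φ <;> rfl

/-- The product of deltas is the indicator of `Compatible`, and `compatibleEquiv` turns compatible
assignments into free choices of one index per face. -/
theorem sum_deltas_eq (G : FeynmanGraph D) (N : ℕ) :
    ∑ a : G.HalfT → Fin D → Fin N, ∑ b : G.HalfP → Fin D → Fin N,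
      (∏ k, delta (a none k) (b none k)) *
      (∏ v, vertexKernel fun i k => a (some (v, i)) k) *
      (∏ v, vertexKernel fun i k => b (some (v, i)) k) *
      ∏ h, ∏ k, delta (a h k) (b (G.pairing h) (G.strand h k)) = (N : ℝ) ^ G.numFaces := by
  classical
  have hterm : ∀ (a : G.HalfT → Fin D → Fin N) (b : G.HalfP → Fin D → Fin N),
      (∏ k, delta (a none k) (b none k)) *
      (∏ v, vertexKernel fun i k => a (some (v, i)) k) *
      (∏ v, vertexKernel fun i k => b (some (v, i)) k) *
      ∏ h, ∏ k, delta (a h k) (b (G.pairing h) (G.strand h k)) =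
        if G.Compatible (a, b) then 1 else 0 := by
    intro a b
    rw [← Fintype.prod_prod_type' (f := fun h k => delta (a h k) (b (G.pairing h) (G.strand h k)))]
    simp only [vertexKernel_eq_ite, delta, Fintype.prod_boole, ite_zero_mul_ite_zero, mul_one]
    refine if_congr ?_ rfl rfl
    simp only [Compatible, and_assoc, Prod.forall]
  have := Fintype.ofFinite G.Face
  simp_rw [hterm]
  rw [← Fintype.sum_prod_type' (f := fun a b => if G.Compatible (a, b) then (1 : ℝ) else 0),
    Finset.sum_boole, ← Fintype.card_subtype, Fintype.card_congr (G.compatibleEquiv N),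
    Fintype.card_fun, Fintype.card_fin, numFaces, Nat.card_eq_fintype_card]
  push_cast
  rfl

theorem amplitude_eq (G : FeynmanGraph D) {N : ℕ} (hN : 0 < N) :
    G.amplitude N = (N : ℝ) ^ (-G.degree) := by
  have hN' : (0 : ℝ) < N := by exact_mod_cast hN
  rw [amplitude, sum_deltas_eq, ← Real.rpow_natCast, ← Real.rpow_natCast, ← Real.rpow_mul hN'.le,
    ← Real.rpow_add hN', ← Real.rpow_add hN', degree]
  congr 1
  ring

/-- The ring graph: a single propagator with untwisted strands that closes on the insertion. -/
def ring (D : ℕ) : FeynmanGraph D where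
  numT := 0
  numP := 0
  pairing := Equiv.refl _
  strand _ := 1

theorem ring_connected (D : ℕ) : (ring D).Connected := by
  have hsub : ∀ x : (ring D).Node, x = none := by
    rintro (_ | (a | a))
    · rfl
    · exact Fin.elim0 a
    · exact Fin.elim0 a
  refine (SimpleGraph.connected_iff_exists_forall_reachable _).2 ⟨none, fun x => ?_⟩
  rw [hsub x]

/-- The faces of the ring graph are its strands. -/
def ringFaceEquiv (D : ℕ) : (ring D).Face ≃ Fin D where
  toFun := Quot.lift (Sum.elim Prod.snd Prod.snd) (by
    rintro _ _ (⟨h, k⟩ | k | ⟨v, i, k⟩ | ⟨v, i, k⟩)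
    · rfl
    · rfl
    · exact Fin.elim0 v
    · exact Fin.elim0 v)
  invFun k := (ring D).face (Sum.inl (none, k))
  left_inv φ := by
    obtain ⟨⟨_ | ⟨v, i⟩, k⟩ | ⟨_ | ⟨v, i⟩, k⟩⟩ := φ
    · rfl
    · exact Fin.elim0 v
    · exact Quot.sound (Glued.insertion k)
    · exact Fin.elim0 v
  right_inv _ := rfl

theorem ring_degree (D : ℕ) : (ring D).degree = 0 := by
  have h : (ring D).numFaces = D := by
    rw [numFaces, Nat.card_congr (ringFaceEquiv D), Nat.card_fin]
  have hV : (ring D).numVertices = 0 := rfl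
  rw [degree, h, hV]
  simp

end FeynmanGraph

end

/-- Every connected Feynman graph has non-negative degree, its amplitude at size `N` is
`N ^ (-degree)`, and the model admits a `1/N` expansion. -/
theorem theorem1 (D : ℕ) (hD : 3 ≤ D) :
    (∀ G : FeynmanGraph D, G.Connected →
      0 ≤ G.degree ∧ ∀ N : ℕ, 0 < N → G.amplitude N = (N : ℝ) ^ (-G.degree)) ∧
    AdmitsLargeNExpansion D := by
  have hdeg : ∀ G : FeynmanGraph D, G.Connected → 0 ≤ G.degree := fun _ hG =>
    hG.degree_nonneg (by omega)
  exact ⟨fun G hG => ⟨hdeg G hG, fun _ hN => G.amplitude_eq hN⟩, hdeg,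
    FeynmanGraph.ring D, FeynmanGraph.ring_connected D, FeynmanGraph.ring_degree D⟩
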